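/- Let $V$ be a finite-dimensional real vector space and let $C\subset V$ be a nonempty open convex cone, with closed dual cone $C^*=\{y\in V^*:\langle y,x\rangle\ge 0 \text{ for all } x\in C\}$. Let $\mathcal M_+(C)$ be the set of Borel measures on $V^*$ that are finite on compact sets and vanish on every Borel subset of $V^*\setminus C^*$. A measure $\mu\in\mathcal M_+(C)$ is said to have a Laplace transform if $\mathcal L\{\mu\}(x):=\int_{C^*}e^{-\langle y,x\rangle}\,d\mu(y)$ converges for every $x\in C$. The convolution is given by $(\mu*\nu)(E)=\int\int\chi_E(y+z)\,d\mu(y)\,d\nu(z)$ for Borel sets $E\subset V^*$. A function $f:C\to\mathbb R$ is completely monotone if it is $\mathcal C^\infty$ and $(-1)^kD_{v_1}\cdots D_{v_k}f(x)\ge 0$ for all $k\ge 0$, all $v_1,\dots,v_k\in C$ and all $x\in C$, where $D_v$ is the directional derivative along $v$. The Riesz measure of $f$ is the unique measure $\mu\in\mathcal M_+(C)$ that has a Laplace transform and satisfies $f=\mathcal L\{\mu\}$ on $C$. (1) If $\mu,\nu\in\mathcal M_+(C)$ have Laplace transforms, then $\mu*\nu$ belongs to $\mathcal M_+(C)$ and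 has a Laplace transform, and $$\mathcal L\{\mu*\nu\}(x)=\mathcal L\{\mu\}(x)\cdot\mathcal L\{\nu\}(x)\qquad\text{for all }x\in C.$$ (2) If $f,g:C\to\mathbb R$ are completely monotone, then $fg$ is completely monotone. Moreover, if $\mu,\nu\in\mathcal M_+(C)$ have Laplace transforms with $f=\mathcal L\{\mu\}$ and $g=\mathcal L\{\nu\}$ on $C$ (that is, if $\mu$ and $\nu$ are the Riesz measures of $f$ and $g$), then $\mu*\nu$ is the Riesz measure of $fg$; in particular it is the only measure in $\mathcal M_+(C)$ whose Laplace transform exists and equals $fg$ on $C$. -/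

import Mathlib

open MeasureTheory
open scoped ContDiff

/-- The closed dual cone `C* = {y ∈ V* : ⟨y, x⟩ ≥ 0 for all x ∈ C}`. -/
def dualCone {V : Type*} [NormedAddCommGroup V] [NormedSpace ℝ V] (C : ConvexCone ℝ V) :
    Set (StrongDual ℝ V) :=
  {y | ∀ x ∈ C, 0 ≤ y x}

/-- The set `M₊(C)` of Borel measures on `V*` that are finite on compact sets and supported
in the closed dual cone `C*`. -/
def supportedMeasures {V : Type*} [NormedAddCommGroup V] [NormedSpace ℝ V] (C : ConvexCone ℝ V) :
    Set (Measure (StrongDual ℝ V)) :=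
  {μ | (∀ K : Set (StrongDual ℝ V), IsCompact K → μ K < ⊤) ∧
    ∀ E : Set (StrongDual ℝ V), MeasurableSet E → E ⊆ (dualCone C)ᶜ → μ E = 0}

/-- The Laplace transform `x ↦ ∫_{C*} exp (-⟨y, x⟩) dμ(y)`; it is meaningful on `C` for the
measures satisfying `HasLaplaceTransform`. -/
noncomputable def laplaceTransform {V : Type*} [NormedAddCommGroup V] [NormedSpace ℝ V]
    (C : ConvexCone ℝ V) (μ : Measure (StrongDual ℝ V)) (x : V) : ℝ :=
  ∫ y in dualCone C, Real.exp (-(y x)) ∂μ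

/-- A measure in `M₊(C)` has a Laplace transform if the defining integral converges at every
point of `C`. -/
def HasLaplaceTransform {V : Type*} [NormedAddCommGroup V] [NormedSpace ℝ V]
    (C : ConvexCone ℝ V) (μ : Measure (StrongDual ℝ V)) : Prop :=
  μ ∈ supportedMeasures C ∧
    ∀ x ∈ C, IntegrableOn (fun y : StrongDual ℝ V => Real.exp (-(y x))) (dualCone C) μ

/-- The iterated directional derivative `D_{v₁} ⋯ D_{vₖ} f` for the list `[v₁, …, vₖ]`. -/
noncomputable def iteratedDirDeriv {V : Type*} [NormedAddCommGroup V] [NormedSpace ℝ V]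
    (f : V → ℝ) : List V → V → ℝ
  | [] => f
  | v :: l => fun x => lineDeriv ℝ (iteratedDirDeriv f l) x v

/-- Complete monotonicity on the (open) cone `C`. Only the values of `f` on `C` matter. -/
def CompletelyMonotone {V : Type*} [NormedAddCommGroup V] [NormedSpace ℝ V]
    (C : ConvexCone ℝ V) (f : V → ℝ) : Prop :=
  ContDiffOn ℝ ∞ f (C : Set V) ∧
    ∀ l : List V, (∀ v ∈ l, v ∈ C) → ∀ x ∈ C, 0 ≤ (-1 : ℝ) ^ l.length * iteratedDirDeriv f l x

/-- `μ` represents `f` on `C`: it is a measure in `M₊(C)` that has a Laplace transform, and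
this transform is `f`. -/
def Represents {V : Type*} [NormedAddCommGroup V] [NormedSpace ℝ V]
    (C : ConvexCone ℝ V) (μ : Measure (StrongDual ℝ V)) (f : V → ℝ) : Prop :=
  HasLaplaceTransform C μ ∧ ∀ x ∈ C, f x = laplaceTransform C μ x

/-- `μ` is the Riesz measure of `f` on `C`: the unique measure representing `f`. -/
def IsRieszMeasure {V : Type*} [NormedAddCommGroup V] [NormedSpace ℝ V]
    (C : ConvexCone ℝ V) (f : V → ℝ) (μ : Measure (StrongDual ℝ V)) : Prop :=
  Represents C μ f ∧ ∀ ρ : Measure (StrongDual ℝ V), Represents C ρ f → ρ = μ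

/-! Multiplicativity is Fubini: the exponential turns `y + z` into a product, and convolution is the
pushforward of the product measure under addition. For uniqueness, tilting by `exp (-⟨y, x⟩)` with
`x ∈ C` gives a finite measure whose moment generating function in direction `v` is `t ↦ L(x - t
v)`, known near `0` since `C` is open; continuing analytically to the imaginary axis yields its
characteristic function (`eq_of_laplaceTransform_eq`). Complete monotonicity of `fg` follows
inductively from `-D_v(fg) = (-D_v f) g + f (-D_v g)`, so no existence theorem for Riesz measures is
needed. -/

section LaplaceTransform

variable {V : Type*} [NormedAddCommGroup V] [NormedSpace ℝ V] {C : ConvexCone ℝ V}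

theorem isClosed_dualCone (C : ConvexCone ℝ V) : IsClosed (dualCone C) := by
  have h : dualCone C = ⋂ x ∈ C, {y : StrongDual ℝ V | 0 ≤ y x} := by
    ext y
    simp [dualCone]
  rw [h]
  exact isClosed_biInter fun x _ =>
    isClosed_le continuous_const (ContinuousLinearMap.apply ℝ ℝ x).continuous

theorem measurable_exp_neg_apply (x : V) :
    Measurable fun y : StrongDual ℝ V => Real.exp (-(y x)) :=
  Real.measurable_exp.comp (ContinuousLinearMap.measurable_apply x).neg

theorem HasLaplaceTransform.measure_compl_dualCone {μ : Measure (StrongDual ℝ V)}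
    (h : HasLaplaceTransform C μ) : μ (dualCone C)ᶜ = 0 :=
  h.1.2 _ (isClosed_dualCone C).measurableSet.compl subset_rfl

theorem HasLaplaceTransform.restrict_dualCone {μ : Measure (StrongDual ℝ V)}
    (h : HasLaplaceTransform C μ) : μ.restrict (dualCone C) = μ :=
  Measure.restrict_eq_self_of_ae_mem (mem_ae_iff.2 h.measure_compl_dualCone)

theorem HasLaplaceTransform.integrable {μ : Measure (StrongDual ℝ V)}
    (h : HasLaplaceTransform C μ) {x : V} (hx : x ∈ C) :
    Integrable (fun y : StrongDual ℝ V => Real.exp (-(y x))) μ := by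
  simpa only [IntegrableOn, h.restrict_dualCone] using h.2 x hx

theorem HasLaplaceTransform.laplaceTransform_eq {μ : Measure (StrongDual ℝ V)}
    (h : HasLaplaceTransform C μ) (x : V) :
    laplaceTransform C μ x = ∫ y, Real.exp (-(y x)) ∂μ := by
  rw [laplaceTransform, h.restrict_dualCone]

/-- Supplies the hypothesis under which Fubini applies to the product measure. -/
theorem HasLaplaceTransform.sigmaFinite [FiniteDimensional ℝ V] {μ : Measure (StrongDual ℝ V)}
    (h : HasLaplaceTransform C μ) : SigmaFinite μ :=
  haveI : IsFiniteMeasureOnCompacts μ := ⟨fun _ hK => h.1.1 _ hK⟩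
  inferInstance

/-- A measure against which some exponential is integrable is finite on compact sets. -/
theorem measure_lt_top_of_integrable_exp {μ : Measure (StrongDual ℝ V)} {x : V}
    (h : Integrable (fun y : StrongDual ℝ V => Real.exp (-(y x))) μ)
    {K : Set (StrongDual ℝ V)} (hK : IsCompact K) : μ K < ⊤ := by
  have hcont : Continuous fun y : StrongDual ℝ V => Real.exp (-(y x)) :=
    Real.continuous_exp.comp (ContinuousLinearMap.apply ℝ ℝ x).continuous.neg
  rcases K.eq_empty_or_nonempty with rfl | hne
  · simp
  obtain ⟨y₀, -, hy₀⟩ := hK.exists_isMinOn hne hcont.continuousOn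
  -- Markov: `K` lies in a superlevel set at the positive minimum of the exponential on `K`.
  refine (measure_mono fun y hy => ?_).trans_lt (h.measure_ge_lt_top (Real.exp_pos (-(y₀ x))))
  exact hy₀ hy

variable [FiniteDimensional ℝ V]

theorem integrable_exp_conv {μ ν : Measure (StrongDual ℝ V)} [SFinite μ] [SFinite ν] {x : V}
    (hμ : Integrable (fun y : StrongDual ℝ V => Real.exp (-(y x))) μ)
    (hν : Integrable (fun y : StrongDual ℝ V => Real.exp (-(y x))) ν) :
    Integrable (fun y : StrongDual ℝ V => Real.exp (-(y x))) (μ.conv ν) := by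
  rw [Measure.conv, integrable_map_measure (measurable_exp_neg_apply x).aestronglyMeasurable
    measurable_add.aemeasurable]
  refine (hμ.mul_prod hν).congr (.of_forall fun p => ?_)
  simp [← Real.exp_add, add_comm]

theorem integral_exp_conv (μ ν : Measure (StrongDual ℝ V)) [SFinite μ] [SFinite ν] (x : V) :
    ∫ y, Real.exp (-(y x)) ∂(μ.conv ν) =
      (∫ y, Real.exp (-(y x)) ∂μ) * ∫ y, Real.exp (-(y x)) ∂ν := by
  rw [Measure.conv, integral_map measurable_add.aemeasurable
    (measurable_exp_neg_apply x).aestronglyMeasurable, ← integral_prod_mul]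
  refine integral_congr_ae (.of_forall fun p => ?_)
  simp [← Real.exp_add, add_comm]

/-- The dual cone is closed under addition, so a sum outside it has a summand outside it. -/
theorem HasLaplaceTransform.conv_compl_dualCone {μ ν : Measure (StrongDual ℝ V)}
    (hμ : HasLaplaceTransform C μ) (hν : HasLaplaceTransform C ν) :
    μ.conv ν (dualCone C)ᶜ = 0 := by
  have := hμ.sigmaFinite
  have := hν.sigmaFinite
  rw [Measure.conv, Measure.map_apply measurable_add
    (isClosed_dualCone C).measurableSet.compl]
  have hsub : (fun p : StrongDual ℝ V × StrongDual ℝ V => p.1 + p.2) ⁻¹' (dualCone C)ᶜ ⊆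
      (dualCone C)ᶜ ×ˢ Set.univ ∪ Set.univ ×ˢ (dualCone C)ᶜ := by
    intro p hp
    by_contra hcon
    simp only [Set.mem_union, Set.mem_prod, Set.mem_compl_iff, Set.mem_univ, and_true, true_and,
      not_or, not_not] at hcon
    exact hp fun x hx => add_nonneg (hcon.1 x hx) (hcon.2 x hx)
  refine measure_mono_null hsub (measure_union_null ?_ ?_)
  · simp [Measure.prod_prod, hμ.measure_compl_dualCone]
  · simp [Measure.prod_prod, hν.measure_compl_dualCone]

theorem HasLaplaceTransform.conv (hne : (C : Set V).Nonempty) {μ ν : Measure (StrongDual ℝ V)}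
    (hμ : HasLaplaceTransform C μ) (hν : HasLaplaceTransform C ν) :
    HasLaplaceTransform C (μ.conv ν) := by
  have := hμ.sigmaFinite
  have := hν.sigmaFinite
  obtain ⟨x₀, hx₀⟩ := hne
  exact ⟨⟨fun K hK => measure_lt_top_of_integrable_exp
      (integrable_exp_conv (hμ.integrable hx₀) (hν.integrable hx₀)) hK,
    fun E _ hE => measure_mono_null hE (hμ.conv_compl_dualCone hν)⟩,
    fun x hx => (integrable_exp_conv (hμ.integrable hx) (hν.integrable hx)).integrableOn⟩

theorem laplaceTransform_conv (hne : (C : Set V).Nonempty) {μ ν : Measure (StrongDual ℝ V)}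
    (hμ : HasLaplaceTransform C μ) (hν : HasLaplaceTransform C ν) (x : V) :
    laplaceTransform C (μ.conv ν) x = laplaceTransform C μ x * laplaceTransform C ν x := by
  have := hμ.sigmaFinite
  have := hν.sigmaFinite
  rw [(hμ.conv hne hν).laplaceTransform_eq, hμ.laplaceTransform_eq, hν.laplaceTransform_eq,
    integral_exp_conv]

end LaplaceTransform

/-! ### Uniqueness of the representing measure -/

section Uniqueness

open ProbabilityTheory Filter Topology

/-- If two moment generating functions are finite and agree near `0`, then the complex moment
generating functions agree on the imaginary axis. -/
theorem complexMGF_I_eq_of_eventually_mgf_eq {Ω Ω' : Type*} {mΩ : MeasurableSpace Ω}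
    {mΩ' : MeasurableSpace Ω'} {μ : Measure Ω} {ν : Measure Ω'} {X : Ω → ℝ} {Y : Ω' → ℝ}
    (hX : ∀ᶠ t in 𝓝 (0 : ℝ), Integrable (fun a => Real.exp (t * X a)) μ)
    (hY : ∀ᶠ t in 𝓝 (0 : ℝ), Integrable (fun a => Real.exp (t * Y a)) ν)
    (h : ∀ᶠ t in 𝓝 (0 : ℝ), mgf X μ t = mgf Y ν t) :
    complexMGF X μ Complex.I = complexMGF Y ν Complex.I := by
  have h0X : (0 : ℝ) ∈ interior (integrableExpSet X μ) := mem_interior_iff_mem_nhds.2 hX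
  have h0Y : (0 : ℝ) ∈ interior (integrableExpSet Y ν) := mem_interior_iff_mem_nhds.2 hY
  -- The strip over `S` is convex, hence preconnected, and contains both `0` and `I`, which have
  -- real part `0`.
  set S : Set ℝ := interior (integrableExpSet X μ) ∩ interior (integrableExpSet Y ν) with hS
  have hSconv : Convex ℝ S :=
    convex_integrableExpSet.interior.inter convex_integrableExpSet.interior
  have hXa : AnalyticOnNhd ℂ (complexMGF X μ) {z | z.re ∈ S} :=
    analyticOnNhd_complexMGF.mono fun z hz => hz.1
  have hYa : AnalyticOnNhd ℂ (complexMGF Y ν) {z | z.re ∈ S} :=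
    analyticOnNhd_complexMGF.mono fun z hz => hz.2
  have hfreq : ∃ᶠ z in 𝓝[≠] ((0 : ℝ) : ℂ), complexMGF X μ z = complexMGF Y ν z := by
    have hreal : ∃ᶠ t : ℝ in 𝓝[≠] 0, complexMGF X μ t = complexMGF Y ν t := by
      refine Eventually.frequently ((h.filter_mono nhdsWithin_le_nhds).mono fun t ht => ?_)
      rw [complexMGF_ofReal, complexMGF_ofReal, ht]
    have htend : Tendsto (fun t : ℝ => (t : ℂ)) (𝓝[≠] 0) (𝓝[≠] ((0 : ℝ) : ℂ)) :=
      tendsto_nhdsWithin_of_tendsto_nhds_of_eventually_within _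
        (Complex.continuous_ofReal.continuousAt.tendsto.mono_left nhdsWithin_le_nhds)
        (eventually_mem_nhdsWithin.mono fun t ht => by simpa using ht)
    exact htend.frequently hreal
  exact hXa.eqOn_of_preconnected_of_frequently_eq hYa
    (hSconv.linear_preimage Complex.reLm).isPreconnected
    (show ((0 : ℝ) : ℂ).re ∈ S from ⟨h0X, h0Y⟩) hfreq
    (show Complex.I.re ∈ S by rw [Complex.I_re]; exact ⟨h0X, h0Y⟩)

variable {V : Type*} [NormedAddCommGroup V] [NormedSpace ℝ V]

/-- The measure `exp (-⟨y, x⟩) dμ(y)`. -/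
noncomputable def expWeight (μ : Measure (StrongDual ℝ V)) (x : V) : Measure (StrongDual ℝ V) :=
  μ.withDensity fun y => ENNReal.ofReal (Real.exp (-(y x)))

theorem isFiniteMeasure_expWeight {μ : Measure (StrongDual ℝ V)} {x : V}
    (h : Integrable (fun y : StrongDual ℝ V => Real.exp (-(y x))) μ) :
    IsFiniteMeasure (expWeight μ x) :=
  isFiniteMeasure_withDensity_ofReal h.2

/-- The density is positive and finite everywhere, so dividing by it recovers the measure. -/
theorem expWeight_injective (x : V) :
    Function.Injective fun μ : Measure (StrongDual ℝ V) => expWeight μ x := by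
  have hm : Measurable fun y : StrongDual ℝ V => ENNReal.ofReal (Real.exp (-(y x))) :=
    (measurable_exp_neg_apply x).ennreal_ofReal
  have hinv (μ : Measure (StrongDual ℝ V)) : (expWeight μ x).withDensity
      (fun y => ENNReal.ofReal (Real.exp (-(y x))))⁻¹ = μ :=
    withDensity_inv_same hm (.of_forall fun y => by simp [Real.exp_pos])
      (.of_forall fun y => ENNReal.ofReal_ne_top)
  intro μ ν h
  rw [← hinv μ, ← hinv ν]
  exact congrArg (Measure.withDensity · _) h

theorem integrable_expWeight_iff {μ : Measure (StrongDual ℝ V)} {x v : V} {t : ℝ} :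
    Integrable (fun y : StrongDual ℝ V => Real.exp (t * y v)) (expWeight μ x) ↔
      Integrable (fun y : StrongDual ℝ V => Real.exp (-(y (x - t • v)))) μ := by
  rw [expWeight, integrable_withDensity_iff_integrable_smul'
    (measurable_exp_neg_apply x).ennreal_ofReal (.of_forall fun y => ENNReal.ofReal_lt_top)]
  refine integrable_congr (.of_forall fun y => ?_)
  simp [ENNReal.toReal_ofReal (Real.exp_pos _).le, ← Real.exp_add, sub_eq_add_neg, add_comm]

theorem mgf_expWeight (μ : Measure (StrongDual ℝ V)) (x v : V) (t : ℝ) :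
    mgf (fun y : StrongDual ℝ V => y v) (expWeight μ x) t =
      ∫ y, Real.exp (-(y (x - t • v))) ∂μ := by
  rw [mgf, expWeight, integral_withDensity_eq_integral_toReal_smul
    (measurable_exp_neg_apply x).ennreal_ofReal (.of_forall fun y => ENNReal.ofReal_lt_top)]
  refine integral_congr_ae (.of_forall fun y => ?_)
  simp [ENNReal.toReal_ofReal (Real.exp_pos _).le, ← Real.exp_add, sub_eq_add_neg, add_comm]

variable [FiniteDimensional ℝ V]

/-- Finite measures on the dual are determined by `v ↦ ∫ exp (i ⟨y, v⟩) dμ(y)`. -/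
theorem ext_of_complexMGF_apply_I {μ ν : Measure (StrongDual ℝ V)} [IsFiniteMeasure μ]
    [IsFiniteMeasure ν]
    (h : ∀ v : V, complexMGF (fun y : StrongDual ℝ V => y v) μ Complex.I =
      complexMGF (fun y : StrongDual ℝ V => y v) ν Complex.I) : μ = ν := by
  refine ext_of_integral_char_eq Real.continuous_probChar
    Real.probChar_ne_one
    (L := ContinuousLinearMap.coeLM (M := V) (N₃ := ℝ) (R := ℝ) ℝ) ?_ ?_ fun v => ?_
  · intro y hy h0
    exact hy (ContinuousLinearMap.coe_injective h0)
  · exact isBoundedBilinearMap_apply.continuous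
  · have h' := h v
    -- `Real.probChar` is `t ↦ exp (i t)`, without a factor `2π`.
    simp only [complexMGF, mul_comm Complex.I] at h'
    exact h'

/-- A measure in `M₊(C)` with a Laplace transform is determined by this transform. -/
theorem eq_of_laplaceTransform_eq {C : ConvexCone ℝ V} (hopen : IsOpen (C : Set V))
    (hne : (C : Set V).Nonempty) {μ ν : Measure (StrongDual ℝ V)}
    (hμ : HasLaplaceTransform C μ) (hν : HasLaplaceTransform C ν)
    (h : ∀ x ∈ C, laplaceTransform C μ x = laplaceTransform C ν x) : μ = ν := by
  obtain ⟨x, hx⟩ := hne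
  have := isFiniteMeasure_expWeight (hμ.integrable hx)
  have := isFiniteMeasure_expWeight (hν.integrable hx)
  refine expWeight_injective x (ext_of_complexMGF_apply_I fun v => ?_)
  have hnear : ∀ᶠ t in 𝓝 (0 : ℝ), x - t • v ∈ C := by
    have hc : ContinuousAt (fun t : ℝ => x - t • v) 0 := by fun_prop
    exact hc.eventually_mem (by simpa using hopen.mem_nhds hx)
  refine complexMGF_I_eq_of_eventually_mgf_eq ?_ ?_ ?_
  · exact hnear.mono fun t ht => integrable_expWeight_iff.2 (hμ.integrable ht)
  · exact hnear.mono fun t ht => integrable_expWeight_iff.2 (hν.integrable ht)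
  · filter_upwards [hnear] with t ht
    rw [mgf_expWeight, mgf_expWeight, ← hμ.laplaceTransform_eq, ← hν.laplaceTransform_eq, h _ ht]

end Uniqueness

/-! ### Products of completely monotone functions -/

section CompletelyMonotone

open Filter Topology

variable {V : Type*} [NormedAddCommGroup V] [NormedSpace ℝ V] {s : Set V}

theorem lineDeriv_eqOn_fderiv (hs : IsOpen s) {f : V → ℝ} (hf : ContDiffOn ℝ ∞ f s) (v : V) :
    Set.EqOn (fun x => lineDeriv ℝ f x v) (fun x => fderiv ℝ f x v) s := fun x hx =>
  ((hf.contDiffAt (hs.mem_nhds hx)).differentiableAt (by simp)).lineDeriv_eq_fderiv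

theorem ContDiffOn.lineDeriv_of_isOpen (hs : IsOpen s) {f : V → ℝ} (hf : ContDiffOn ℝ ∞ f s)
    (v : V) : ContDiffOn ℝ ∞ (fun x => lineDeriv ℝ f x v) s :=
  ((hf.fderiv_of_isOpen hs (m := ∞) (by simp)).clm_apply contDiffOn_const).congr
    (lineDeriv_eqOn_fderiv hs hf v)

theorem ContDiffOn.iteratedDirDeriv (hs : IsOpen s) {f : V → ℝ} (hf : ContDiffOn ℝ ∞ f s)
    (l : List V) : ContDiffOn ℝ ∞ (iteratedDirDeriv f l) s := by
  induction l with
  | nil => exact hf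
  | cons v l ih => exact ih.lineDeriv_of_isOpen hs v

theorem lineDeriv_congr_of_eqOn (hs : IsOpen s) {f g : V → ℝ} (h : Set.EqOn f g s) (v : V) :
    Set.EqOn (fun x => lineDeriv ℝ f x v) (fun x => lineDeriv ℝ g x v) s := fun _ hx =>
  (h.eventuallyEq_of_mem (hs.mem_nhds hx)).lineDeriv_eq

theorem iteratedDirDeriv_congr_of_eqOn (hs : IsOpen s) {f g : V → ℝ} (h : Set.EqOn f g s)
    (l : List V) : Set.EqOn (iteratedDirDeriv f l) (iteratedDirDeriv g l) s := by
  induction l with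
  | nil => exact h
  | cons v l ih => exact lineDeriv_congr_of_eqOn hs ih v

/-- The recursion peels off the outermost derivative; the product argument needs the innermost one.
-/
theorem iteratedDirDeriv_concat (f : V → ℝ) (l : List V) (v : V) :
    iteratedDirDeriv f (l ++ [v]) = iteratedDirDeriv (fun x => lineDeriv ℝ f x v) l := by
  induction l with
  | nil => rfl
  | cons w l ih => rw [List.cons_append, iteratedDirDeriv, ih, iteratedDirDeriv]

theorem iteratedDirDeriv_neg_add (hs : IsOpen s) {f g : V → ℝ} (hf : ContDiffOn ℝ ∞ f s)
    (hg : ContDiffOn ℝ ∞ g s) (l : List V) :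
    Set.EqOn (iteratedDirDeriv (fun x => -(f x + g x)) l)
      (fun x => -(iteratedDirDeriv f l x + iteratedDirDeriv g l x)) s := by
  induction l with
  | nil => exact fun x _ => rfl
  | cons v l ih =>
    intro x hx
    have hF := ((hf.iteratedDirDeriv hs l).contDiffAt (hs.mem_nhds hx)).differentiableAt (by simp)
    have hG := ((hg.iteratedDirDeriv hs l).contDiffAt (hs.mem_nhds hx)).differentiableAt (by simp)
    refine (lineDeriv_congr_of_eqOn hs ih v hx).trans ?_
    exact ((hF.lineDifferentiableAt.hasLineDerivAt (v := v)).add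
      hG.lineDifferentiableAt.hasLineDerivAt).neg.deriv

theorem iteratedDirDeriv_neg (f : V → ℝ) (l : List V) :
    iteratedDirDeriv (fun x => -f x) l = fun x => -iteratedDirDeriv f l x := by
  induction l with
  | nil => rfl
  | cons v l ih =>
    ext x
    rw [iteratedDirDeriv, ih]
    exact deriv.fun_neg

/-- Signs are placed so that, for completely monotone `f`, `g` and `v ∈ C`, both summands are again
products of completely monotone functions. -/
theorem lineDeriv_mul_eqOn (hs : IsOpen s) {f g : V → ℝ} (hf : ContDiffOn ℝ ∞ f s)
    (hg : ContDiffOn ℝ ∞ g s) (v : V) :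
    Set.EqOn (fun x => lineDeriv ℝ (fun x => f x * g x) x v)
      (fun x => -(-lineDeriv ℝ f x v * g x + f x * -lineDeriv ℝ g x v)) s := by
  intro x hx
  have hF := (hf.contDiffAt (hs.mem_nhds hx)).differentiableAt (by simp)
  have hG := (hg.contDiffAt (hs.mem_nhds hx)).differentiableAt (by simp)
  have h := ((hF.lineDifferentiableAt.hasLineDerivAt (v := v)).mul
    (hG.lineDifferentiableAt.hasLineDerivAt (v := v))).deriv
  simp only [zero_smul, add_zero] at h
  refine h.trans ?_
  ring

variable {C : ConvexCone ℝ V}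

theorem CompletelyMonotone.neg_lineDeriv (hopen : IsOpen (C : Set V)) {f : V → ℝ}
    (hf : CompletelyMonotone C f) {v : V} (hv : v ∈ C) :
    CompletelyMonotone C fun x => -lineDeriv ℝ f x v := by
  refine ⟨(hf.1.lineDeriv_of_isOpen hopen v).neg, fun l hl x hx => ?_⟩
  have h := hf.2 (l ++ [v]) (by simpa [or_imp, forall_and] using ⟨hl, hv⟩) x hx
  rw [iteratedDirDeriv_concat] at h
  rw [iteratedDirDeriv_neg]
  simpa [pow_succ] using h

theorem CompletelyMonotone.mul (hopen : IsOpen (C : Set V)) {f g : V → ℝ}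
    (hf : CompletelyMonotone C f) (hg : CompletelyMonotone C g) :
    CompletelyMonotone C fun x => f x * g x := by
  refine ⟨hf.1.mul hg.1, fun l => ?_⟩
  -- The induction hypothesis is used for the pairs `(-D_v f, g)` and `(f, -D_v g)`.
  induction l using List.reverseRecOn generalizing f g with
  | nil =>
    intro _ x hx
    simpa [iteratedDirDeriv] using
      mul_nonneg (by simpa [iteratedDirDeriv] using hf.2 [] (by simp) x hx)
        (by simpa [iteratedDirDeriv] using hg.2 [] (by simp) x hx)
  | append_singleton l v ih =>
    intro hl x hx
    have hl' : ∀ w ∈ l, w ∈ C := fun w hw => hl w (by simp [hw])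
    have hf' := hf.neg_lineDeriv hopen (hl v (by simp))
    have hg' := hg.neg_lineDeriv hopen (hl v (by simp))
    rw [iteratedDirDeriv_concat,
      iteratedDirDeriv_congr_of_eqOn hopen (lineDeriv_mul_eqOn hopen hf.1 hg.1 v) l hx,
      iteratedDirDeriv_neg_add hopen (hf'.1.mul hg.1) (hf.1.mul hg'.1) l hx]
    have h₁ := ih hf' hg hl' x hx
    have h₂ := ih hf hg' hl' x hx
    rw [List.length_append, List.length_singleton, pow_succ]
    linarith

end CompletelyMonotone

theorem proposition5p3 {V : Type*} [NormedAddCommGroup V] [NormedSpace ℝ V]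
    [FiniteDimensional ℝ V] (C : ConvexCone ℝ V) (hopen : IsOpen (C : Set V))
    (hne : (C : Set V).Nonempty) :
    (∀ μ ν : Measure (StrongDual ℝ V), HasLaplaceTransform C μ → HasLaplaceTransform C ν →
      HasLaplaceTransform C (μ.conv ν) ∧
        ∀ x ∈ C, laplaceTransform C (μ.conv ν) x
          = laplaceTransform C μ x * laplaceTransform C ν x) ∧
    (∀ f g : V → ℝ, CompletelyMonotone C f → CompletelyMonotone C g →
      CompletelyMonotone C (fun x => f x * g x) ∧
        ∀ μ ν : Measure (StrongDual ℝ V), Represents C μ f → Represents C ν g →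
          IsRieszMeasure C (fun x => f x * g x) (μ.conv ν)) := by
  refine ⟨fun μ ν hμ hν => ⟨hμ.conv hne hν, fun x _ => laplaceTransform_conv hne hμ hν x⟩,
    fun f g hf hg => ⟨hf.mul hopen hg, fun μ ν hμ hν => ?_⟩⟩
  have hrep : Represents C (μ.conv ν) fun x => f x * g x :=
    ⟨hμ.1.conv hne hν.1, fun x hx => by
      simp only [laplaceTransform_conv hne hμ.1 hν.1, hμ.2 x hx, hν.2 x hx]⟩
  exact ⟨hrep, fun ρ hρ => eq_of_laplaceTransform_eq hopen hne hρ.1 hrep.1 fun x hx =>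
    (hρ.2 x hx).symm.trans (hrep.2 x hx)⟩
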